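/- There exist absolute constants $C,\eta,\kappa>0$ such that the following holds. Let $m\ge 0$ and $n\ge 1$ be integers and let $A\in\mathbb R^{m\times n}$ satisfy $\|A\|_{1\to\infty}\le 1$ (operator norm from $\ell^1$ to $\ell^\infty$; equivalently, $|A_{ij}|\le 1$ for all $i,j$). Independently sample a standard Gaussian vector $g\sim\mathcal N(0,1)^{\otimes n}$ and $C_{\rm Alg}$ uniform on $[C,2C]$, and let $$\Gamma_{A,C_{\rm Alg}}:=\Big\{x\in\mathbb R^n:\ \|Ax\|_\infty\le C_{\rm Alg}\sqrt{n\log(m/n+2)}\ \text{ and }\ \|x\|_\infty\le 1\Big\}.$$ Then: 1. with probability at least $1-e^{-\kappa n}$, we have $\|g\|_2\le 2\sqrt n$; 2. if $n\ge 2$ and $\epsilon:=1/\log n$, then with probability at least $4/5$ the following holds: every $x\in\Gamma_{A,C_{\rm Alg}}$ with $$\frac{\langle g,x\rangle}{\sqrt n}\ \ge\ \sup_{y\in\Gamma_{A,C_{\rm Alg}}}\frac{\langle g,y\rangle}{\sqrt n}-\epsilon\,\eta\sqrt n$$ satisfies $$\#\{j\in\{1,\dots,n\}:\ |x_j|\ge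 1-\epsilon\}\ \ge\ \eta n.$$ -/

import Mathlib

open MeasureTheory ProbabilityTheory

/-- The norm `‖A‖_{1 → ∞}` of a real matrix: the operator norm of `x ↦ A x` as a map from `ℝⁿ` with
the `ℓ¹` norm to `ℝᵐ` with the `ℓ^∞` norm. -/
noncomputable def oneToInftyNorm {m n : ℕ} (A : Matrix (Fin m) (Fin n) ℝ) : ℝ :=
  ‖LinearMap.toContinuousLinearMap (Matrix.toLpLin 1 ⊤ A)‖

/-- The condition `‖A‖_{1 → ∞} ≤ 1` says that all entries of `A` have absolute value at most `1`. -/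
theorem oneToInftyNorm_le_one_iff {m n : ℕ} (A : Matrix (Fin m) (Fin n) ℝ) :
    oneToInftyNorm A ≤ 1 ↔ ∀ i j, |A i j| ≤ 1 := by
  unfold oneToInftyNorm
  constructor
  · intro h i j
    have h1 := ContinuousLinearMap.le_of_opNorm_le _ h (WithLp.toLp 1 (Pi.single j (1 : ℝ)))
    have h2 := (PiLp.norm_apply_le
      ((LinearMap.toContinuousLinearMap (Matrix.toLpLin 1 ⊤ A))
        (WithLp.toLp 1 (Pi.single j (1 : ℝ)))) i).trans h1
    simpa [Matrix.toLpLin_apply] using h2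
  · intro h
    refine ContinuousLinearMap.opNorm_le_bound _ zero_le_one fun x => ?_
    rw [PiLp.norm_eq_ciSup]
    refine Real.iSup_le (fun i => ?_) (by positivity)
    rw [PiLp.norm_eq_of_nat 1 (by simp)]
    simp only [LinearMap.coe_toContinuousLinearMap', Matrix.toLpLin_apply, Matrix.mulVec,
      dotProduct, Real.norm_eq_abs, pow_one, one_mul, Nat.cast_one, div_one, Real.rpow_one]
    refine (Finset.abs_sum_le_sum_abs _ _).trans (Finset.sum_le_sum fun j _ => ?_)
    rw [abs_mul]
    exact mul_le_of_le_one_left (abs_nonneg _) (h i j)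

/-- The feasible region `Γ_{A, c}` of the linear program. The norm on `Fin k → ℝ` is the
`ℓ^∞` norm. -/
def feasibleRegion {m n : ℕ} (A : Matrix (Fin m) (Fin n) ℝ) (c : ℝ) : Set (Fin n → ℝ) :=
  {x | ‖A.mulVec x‖ ≤ c * √(n * Real.log (m / n + 2)) ∧ ‖x‖ ≤ 1}

/-- The law `N(0, 1)^{⊗ n}` of a standard Gaussian vector in `ℝⁿ`. -/
noncomputable def gaussianVector (n : ℕ) : Measure (Fin n → ℝ) :=
  Measure.pi fun _ => gaussianReal 0 1

/-- The uniform distribution on the interval `[a, b]` (a probability measure for `a < b`). -/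
noncomputable def uniformInterval (a b : ℝ) : Measure ℝ :=
  ProbabilityTheory.cond volume (Set.Icc a b)

/-- The optimal value `sup_{y ∈ Γ_{A, c}} ⟨g, y⟩ / √n` of the normalized linear program. -/
noncomputable def lpOpt {m n : ℕ} (A : Matrix (Fin m) (Fin n) ℝ) (c : ℝ) (g : Fin n → ℝ) : ℝ :=
  sSup ((fun y => g ⬝ᵥ y / √n) '' feasibleRegion A c)

/-! Near-optimality forces many large coordinates because otherwise an explicit perturbation
improves the point. Let `S` be the set of coordinates with `|x j| ≥ 1 - ε`, and suppose it is small.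
If some `z` in the cube vanishes on `S`, has `‖A z‖∞ ≤ K √(n log(m/n + 2))` and satisfies `⟨g, z⟩ ≥
n / 160`, then `x + ε z` stays in the cube. Rescaling by `c / (c + ε K)` restores the constraint on
`A`, and for `c` large against `K` the gain of order `ε n` exceeds both the rescaling loss and the
allowed slack (`card_large_coords_of_near_optimal`).

The direction `z` comes from discrepancy theory (`exists_sign_perturbation`). After the columns in
`S` are zeroed, an entropy form of the pigeonhole principle gives a class of at least `2 ^ n * exp
(-δ n)` sign vectors on which `A w` is nearly constant (`exists_large_class_of_log`). By
concentration on the cube (`card_far_mul_card_le`), most sign patterns `s` have both `s` and `-s`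
close to members `w`, `w'` of the class. Half of `w - w'` then mostly agrees with `s`, and its image
under `A` is small. The exceptional proportion is exponentially small, so it survives a union bound
over all small `S`.

The sign pattern of `g` is uniform on the cube, and Markov bounds on `∑ g j ^ 2` and on the number
of small `|g j|` turn agreement of signs into a large inner product. The good event concerns `g`
alone and serves every `c` in `[C, 2C]` at once. -/

/-! ### Concentration on the discrete cube. -/

/-- Exponential concentration on the discrete cube for functions that change by at most `1` when one
coordinate is changed. -/
theorem sum_exp_mul_sum_exp_neg_le (l : ℝ) (hl : 0 ≤ l) : ∀ (n : ℕ) (F : (Fin n → Bool) → ℝ),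
    (∀ x i b, F (Function.update x i b) ≤ F x + 1) →
    (∑ x, Real.exp (l * F x)) * (∑ x, Real.exp (-(l * F x))) ≤ (2 + 2 * Real.cosh l) ^ n := by
  intro n
  induction n with
  | zero =>
    intro F _
    simp [← Real.exp_add]
  | succ n ih =>
    intro F hF
    have split : ∀ f : (Fin (n + 1) → Bool) → ℝ,
        ∑ x, f x = ∑ x : Fin n → Bool, f (Fin.cons true x) + ∑ x : Fin n → Bool, f (Fin.cons false x) := by
      intro f
      rw [← (Fin.consEquiv fun _ => Bool).sum_comp, Fintype.sum_prod_type]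
      simp [Fin.consEquiv]
    rw [split, split]
    have h1 := ih (fun x => F (Fin.cons true x)) (fun x i b => by
      have := hF (Fin.cons true x) i.succ b
      rwa [← Fin.cons_update] at this)
    have h0 := ih (fun x => F (Fin.cons false x)) (fun x i b => by
      have := hF (Fin.cons false x) i.succ b
      rwa [← Fin.cons_update] at this)
    have h10 : ∀ x : Fin n → Bool, F (Fin.cons true x) ≤ F (Fin.cons false x) + 1 := fun x => by
      have := hF (Fin.cons false x) 0 true
      rwa [Fin.update_cons_zero] at this
    have h01 : ∀ x : Fin n → Bool, F (Fin.cons false x) ≤ F (Fin.cons true x) + 1 := fun x => by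
      have := hF (Fin.cons true x) 0 false
      rwa [Fin.update_cons_zero] at this
    have comp : ∀ f g : (Fin n → Bool) → ℝ, (∀ x, f x ≤ g x + 1) →
        ∑ x, Real.exp (l * f x) ≤ Real.exp l * ∑ x, Real.exp (l * g x) := by
      intro f g hfg
      rw [Finset.mul_sum]
      refine Finset.sum_le_sum fun x _ => ?_
      rw [← Real.exp_add, Real.exp_le_exp]
      nlinarith [hfg x]
    have hA10 := comp _ _ h10
    have hA01 := comp _ _ h01
    have pos : ∀ f : (Fin n → Bool) → ℝ, 0 < ∑ x, Real.exp (f x) := fun f =>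
      Finset.sum_pos (fun x _ => Real.exp_pos _) Finset.univ_nonempty
    have pA1 := pos fun x => l * F (Fin.cons true x)
    have pA0 := pos fun x => l * F (Fin.cons false x)
    set A1 := ∑ x : Fin n → Bool, Real.exp (l * F (Fin.cons true x))
    set A0 := ∑ x : Fin n → Bool, Real.exp (l * F (Fin.cons false x))
    set B1 := ∑ x : Fin n → Bool, Real.exp (-(l * F (Fin.cons true x)))
    set B0 := ∑ x : Fin n → Bool, Real.exp (-(l * F (Fin.cons false x)))
    set a := (2 + 2 * Real.cosh l) ^ n
    have ha : 0 ≤ a := by have := Real.cosh_pos l; positivity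
    -- The cross terms reduce to the induction hypothesis at the price of the ratios `A0 / A1` and
    -- `A1 / A0`. These are mutually inverse and at most `exp l`, so their sum is at most `2 cosh
    -- l`.
    have e1 : A0 * B1 ≤ A0 / A1 * a := by
      calc A0 * B1 = A0 / A1 * (A1 * B1) := by field_simp
        _ ≤ _ := by gcongr
    have e2 : A1 * B0 ≤ A1 / A0 * a := by
      calc A1 * B0 = A1 / A0 * (A0 * B0) := by field_simp
        _ ≤ _ := by gcongr
    have e3 : A0 / A1 + A1 / A0 ≤ 2 * Real.cosh l := by
      have hr : A0 / A1 ≤ Real.exp l := by rwa [div_le_iff₀ pA1]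
      have hr' : A1 / A0 ≤ Real.exp l := by rwa [div_le_iff₀ pA0]
      have hrp : 0 < A0 / A1 := by positivity
      have hrr : A0 / A1 * (A1 / A0) = 1 := by field_simp
      have hee : Real.exp l * Real.exp (-l) = 1 := by rw [← Real.exp_add]; simp
      rw [Real.cosh_eq]
      set r := A0 / A1
      set s := A1 / A0
      set E := Real.exp l
      have hE : 0 < E := Real.exp_pos l
      have : 0 ≤ (E - r) * (E - s) := mul_nonneg (by linarith) (by linarith)
      have h2 : (r + s) * E ≤ (E + Real.exp (-l)) * E := by nlinarith
      have := le_of_mul_le_mul_right h2 hE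
      linarith
    calc (A1 + A0) * (B1 + B0) = A1 * B1 + A0 * B0 + (A0 * B1 + A1 * B0) := by ring
      _ ≤ a + a + (A0 / A1 * a + A1 / A0 * a) := by gcongr
      _ = (2 + (A0 / A1 + A1 / A0)) * a := by ring
      _ ≤ (2 + 2 * Real.cosh l) * a := by gcongr
      _ = _ := by rw [pow_succ]; ring

theorem two_add_two_cosh_le (l : ℝ) : 2 + 2 * Real.cosh l ≤ 4 * Real.exp (l ^ 2 / 4) := by
  have h := Real.cosh_le_exp_half_sq (l / 2)
  have h2 : Real.cosh l = 2 * Real.cosh (l / 2) ^ 2 - 1 := by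
    have := Real.cosh_two_mul (l / 2)
    have h3 := Real.cosh_sq (l / 2)
    rw [show 2 * (l / 2) = l by ring] at this
    linarith
  have h3 : Real.exp (l ^ 2 / 4) = Real.exp ((l / 2) ^ 2 / 2) ^ 2 := by
    rw [← Real.exp_nat_mul]; congr 1; push_cast; ring
  have := Real.cosh_pos (l / 2)
  rw [h2, h3]
  nlinarith [pow_le_pow_left₀ this.le h 2]

/-- A set of sign patterns of proportion `p` leaves at most a proportion `exp (-t² n) / p` of the
cube at Hamming distance more than `t n`. -/
theorem card_far_mul_card_le {n : ℕ} (T : Finset (Fin n → Bool)) {t : ℝ} (ht : 0 ≤ t) :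
    ((Finset.univ.filter fun s => ∀ w ∈ T, t * n < (hammingDist s w : ℝ)).card : ℝ) * T.card
      ≤ 4 ^ n * Real.exp (-(t ^ 2 * n)) := by
  rcases T.eq_empty_or_nonempty with rfl | hT
  · simp; positivity
  set F : (Fin n → Bool) → ℝ := fun s => T.inf' hT fun w => (hammingDist s w : ℝ)
  have hF : ∀ x i b, F (Function.update x i b) ≤ F x + 1 := by
    intro x i b
    obtain ⟨w, hw, he⟩ := Finset.exists_mem_eq_inf' hT fun w => (hammingDist x w : ℝ)
    have h1 : F (Function.update x i b) ≤ (hammingDist (Function.update x i b) w : ℝ) :=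
      Finset.inf'_le _ hw
    have h2 : hammingDist (Function.update x i b) x ≤ 1 := by
      unfold hammingDist
      refine (Finset.card_le_card (t := {i}) fun j hj => ?_).trans (by simp)
      by_contra h
      simp at h
      simp [h] at hj
    have h3 := hammingDist_triangle (Function.update x i b) x w
    have h4 : F x = hammingDist x w := he
    rw [h4]
    refine h1.trans ?_
    exact_mod_cast (by omega : hammingDist (Function.update x i b) w ≤ hammingDist x w + 1)
  set U := Finset.univ.filter fun s => ∀ w ∈ T, t * n < (hammingDist s w : ℝ)
  -- The parameter `l = 2 t` minimises the exponent `l ^ 2 / 4 - l * t`.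
  have main := sum_exp_mul_sum_exp_neg_le (2 * t) (by positivity) n F hF
  have hT' : (T.card : ℝ) ≤ ∑ x, Real.exp (-(2 * t * F x)) := by
    calc (T.card : ℝ) = ∑ x ∈ T, 1 := by simp
      _ ≤ ∑ x ∈ T, Real.exp (-(2 * t * F x)) := by
        refine Finset.sum_le_sum fun x hx => ?_
        have : F x ≤ 0 := (Finset.inf'_le _ hx).trans (by simp)
        rw [Real.one_le_exp_iff]
        nlinarith
      _ ≤ _ := Finset.sum_le_sum_of_subset_of_nonneg (Finset.subset_univ _)
        fun _ _ _ => (Real.exp_pos _).le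
  have hU' : (U.card : ℝ) * Real.exp (2 * t * (t * n)) ≤ ∑ x, Real.exp (2 * t * F x) := by
    calc (U.card : ℝ) * Real.exp (2 * t * (t * n)) = ∑ x ∈ U, Real.exp (2 * t * (t * n)) := by simp
      _ ≤ ∑ x ∈ U, Real.exp (2 * t * F x) := by
        refine Finset.sum_le_sum fun x hx => ?_
        have : t * n ≤ F x := Finset.le_inf' _ _ fun w hw => ((Finset.mem_filter.1 hx).2 w hw).le
        rw [Real.exp_le_exp]
        gcongr
      _ ≤ _ := Finset.sum_le_sum_of_subset_of_nonneg (Finset.subset_univ _)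
        fun _ _ _ => (Real.exp_pos _).le
  have h5 : (2 + 2 * Real.cosh (2 * t)) ^ n ≤ 4 ^ n * Real.exp (t ^ 2 * n) := by
    calc _ ≤ (4 * Real.exp ((2 * t) ^ 2 / 4)) ^ n :=
          pow_le_pow_left₀ (by have := Real.cosh_pos (2 * t); positivity) (two_add_two_cosh_le _) n
      _ = _ := by rw [mul_pow, ← Real.exp_nat_mul]; congr 2; ring
  have h6 : (U.card : ℝ) * Real.exp (2 * t * (t * n)) * T.card ≤ 4 ^ n * Real.exp (t ^ 2 * n) :=
    (mul_le_mul hU' hT' (by positivity) (by positivity)).trans (main.trans h5)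
  have h7 : Real.exp (t ^ 2 * n) = Real.exp (-(t ^ 2 * n)) * Real.exp (2 * t * (t * n)) := by
    rw [← Real.exp_add]; congr 1; ring
  rw [h7] at h6
  refine le_of_mul_le_mul_right (a := Real.exp (2 * t * (t * n))) ?_ (Real.exp_pos _)
  linarith

/-! ### Entropy pigeonhole for the images of sign vectors. -/

/-- The real sign `±1` of a Boolean. -/
def boolSign (b : Bool) : ℝ := if b then 1 else -1

@[simp] theorem abs_boolSign (b : Bool) : |boolSign b| = 1 := by cases b <;> simp [boolSign]

theorem sum_exp_signs {n : ℕ} (a : Fin n → ℝ) :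
    ∑ w : Fin n → Bool, Real.exp (∑ j, a j * boolSign (w j)) = ∏ j, (2 * Real.cosh (a j)) := by
  have h := Finset.prod_univ_sum (fun _ : Fin n => (Finset.univ : Finset Bool))
    (fun j b => Real.exp (a j * boolSign b))
  rw [Fintype.piFinset_univ] at h
  simp only [Real.exp_sum]
  rw [← h]
  refine Finset.prod_congr rfl fun j _ => ?_
  simp [boolSign, Real.cosh_eq]
  ring

theorem sum_exp_signs_le {n : ℕ} {a : Fin n → ℝ} (ha : ∀ j, |a j| ≤ 1) (l : ℝ) :
    ∑ w : Fin n → Bool, Real.exp (l * ∑ j, a j * boolSign (w j))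
      ≤ 2 ^ n * Real.exp (l ^ 2 * n / 2) := by
  have h := sum_exp_signs fun j => l * a j
  simp only [mul_assoc, ← Finset.mul_sum] at h
  rw [h, Finset.prod_mul_distrib]
  simp only [Finset.prod_const, Finset.card_univ, Fintype.card_fin]
  gcongr
  calc ∏ j, Real.cosh (l * a j) ≤ ∏ j : Fin n, Real.exp (l ^ 2 / 2) := by
        refine Finset.prod_le_prod (fun j _ => (Real.cosh_pos _).le) fun j _ => ?_
        refine (Real.cosh_le_exp_half_sq _).trans (Real.exp_le_exp.2 ?_)
        have : a j ^ 2 ≤ 1 := (sq_le_one_iff_abs_le_one _).2 (ha j)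
        nlinarith [sq_nonneg l]
    _ = _ := by
      rw [Finset.prod_const, ← Real.exp_nat_mul]; simp; ring

/-- The rounding vanishes for `|y| < B`. Beyond that it is at most `|y| / B ≤ 1 + l (|y| - B)`,
which lies below the exponential. Mean rounded values are thus controlled by exponential moments. -/
theorem abs_round_le_exp {B y l : ℝ} (hB : 0 < B) (hl : 1 ≤ l * B) :
    |(round (y / (2 * B)) : ℝ)| ≤ Real.exp (-(l * B)) * (Real.exp (l * y) + Real.exp (l * (-y))) := by
  have hl0 : 0 < l := by by_contra h; nlinarith
  have key : |(round (y / (2 * B)) : ℝ)| ≤ Real.exp (l * (|y| - B)) := by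
    rcases lt_or_ge |y| B with h | h
    · have : round (y / (2 * B)) = 0 := by
        rw [round_eq_zero_iff]
        have := abs_lt.1 h
        constructor
        · rw [le_div_iff₀ (by positivity)]; linarith
        · rw [div_lt_iff₀ (by positivity)]; linarith
      rw [this]; simp; positivity
    · have h1 := abs_sub_round (y / (2 * B))
      have h2 : |(round (y / (2 * B)) : ℝ)| ≤ |y / (2 * B)| + 1 / 2 := by
        have := abs_sub_abs_le_abs_sub ((round (y / (2 * B)) : ℤ) : ℝ) (y / (2 * B))
        rw [abs_sub_comm] at this
        linarith
      rw [abs_div, abs_of_pos (show 0 < 2 * B by positivity)] at h2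
      have h3 : |y| / (2 * B) + 1 / 2 ≤ |y| / B := by
        rw [div_add_div _ _ (by positivity) (by positivity), div_le_div_iff₀ (by positivity) hB]
        nlinarith
      have h4 : |y| / B ≤ 1 + l * (|y| - B) := by
        rw [div_le_iff₀ hB]
        nlinarith
      have := Real.add_one_le_exp (l * (|y| - B))
      linarith
  refine key.trans ?_
  rw [mul_add, ← Real.exp_add, ← Real.exp_add]
  rcases abs_cases y with ⟨h, _⟩ | ⟨h, _⟩ <;> rw [h]
  · rw [show l * (y - B) = -(l * B) + l * y by ring]
    linarith [Real.exp_pos (-(l * B) + l * (-y))]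
  · rw [show l * (-y - B) = -(l * B) + l * (-y) by ring]
    linarith [Real.exp_pos (-(l * B) + l * y)]

/-- With `q = exp (-l)`, the sum over all integers is `(1 + q) / (1 - q)`, at most `1 + 4 q` when `q
≤ 1 / 2`. -/
theorem sum_exp_neg_abs_int_le {l : ℝ} (hl : Real.exp (-l) ≤ 1 / 2) (s : Finset ℤ) :
    ∑ k ∈ s, Real.exp (-(l * |(k : ℝ)|)) ≤ Real.exp (4 * Real.exp (-l)) := by
  set q := Real.exp (-l) with hq
  have hq0 : 0 < q := Real.exp_pos _
  have g := hasSum_geometric_of_lt_one hq0.le (by linarith : q < 1)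
  have h1 : HasSum (fun n : ℕ => Real.exp (-(l * |((n : ℤ) : ℝ)|))) (1 - q)⁻¹ := by
    convert g using 2 with n
    rw [hq, ← Real.exp_nat_mul]; congr 1; simp; ring
  have h2 : HasSum (fun n : ℕ => Real.exp (-(l * |((-((n : ℤ) + 1) : ℤ) : ℝ)|))) (q * (1 - q)⁻¹) := by
    have e : (fun n : ℕ => Real.exp (-(l * |((-((n : ℤ) + 1) : ℤ) : ℝ)|))) = fun n => q * q ^ n := by
      funext n
      rw [hq, ← Real.exp_nat_mul, ← Real.exp_add]; congr 1
      push_cast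
      rw [abs_neg, abs_of_nonneg (by positivity)]; ring
    rw [e]
    exact g.mul_left q
  have h3 := HasSum.of_nat_of_neg_add_one (f := fun k : ℤ => Real.exp (-(l * |(k : ℝ)|))) h1 h2
  refine (sum_le_hasSum s (fun _ _ => (Real.exp_pos _).le) h3).trans ?_
  have h4 := Real.add_one_le_exp (4 * q)
  refine le_trans ?_ h4
  rw [← one_add_mul, ← div_eq_mul_inv, div_le_iff₀ (by linarith)]
  nlinarith

/-- Pigeonhole: a large set of sign patterns on which `w ↦ A w` varies by at most `2 B` in each
coordinate. -/
theorem exists_large_class {m n : ℕ} (hn : 1 ≤ n) {A : Matrix (Fin m) (Fin n) ℝ}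
    (hA : ∀ i j, |A i j| ≤ 1) {B l : ℝ} (hB : 0 < B) (hBn : n ≤ B ^ 2) (hl0 : 0 ≤ l)
    (hl : Real.exp (-l) ≤ 1 / 2) :
    ∃ T : Finset (Fin n → Bool),
      2 ^ n * Real.exp (-(l * (2 * m * Real.exp (-(B ^ 2 / (2 * n)))) + 4 * m * Real.exp (-l)))
        ≤ T.card ∧
      ∀ w ∈ T, ∀ w' ∈ T, ∀ i,
        |∑ j, A i j * boolSign (w j) - ∑ j, A i j * boolSign (w' j)| ≤ 2 * B := by
  have hn' : (0 : ℝ) < n := by exact_mod_cast hn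
  set Y : Fin m → (Fin n → Bool) → ℝ := fun i w => ∑ j, A i j * boolSign (w j) with hY
  set b : (Fin n → Bool) → Fin m → ℤ := fun w i => round (Y i w / (2 * B)) with hb
  set U : Finset (Fin m → ℤ) := Fintype.piFinset fun i => Finset.univ.image fun w => b w i
  -- Weighting the buckets replaces counting them: the total weight is at most `exp (4 m exp (-l))`,
  -- while a typical `w` falls in a bucket of weight about `exp (-c)`, so some bucket must hold many
  -- `w`.
  set W : (Fin m → ℤ) → ℝ := fun k => ∏ i, Real.exp (-(l * |(k i : ℝ)|))
  set e := Real.exp (-(B ^ 2 / (2 * n)))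
  have hmean : ∑ w, ∑ i, |(b w i : ℝ)| ≤ 2 ^ n * (2 * m * e) := by
    rw [Finset.sum_comm]
    calc ∑ i, ∑ w, |(b w i : ℝ)| ≤ ∑ i : Fin m, 2 ^ n * (2 * e) := by
          refine Finset.sum_le_sum fun i _ => ?_
          -- The Chernoff exponent minimising `r ^ 2 * n / 2 - r * B`; `n ≤ B ^ 2` gives `r * B ≥
          -- 1`.
          set r := B / n
          have hr : 1 ≤ r * B := by
            rw [div_mul_eq_mul_div, le_div_iff₀ hn']; nlinarith
          have hs : ∀ l' : ℝ, l' ^ 2 = r ^ 2 →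
              ∑ w, Real.exp (l' * Y i w) ≤ 2 ^ n * Real.exp (r ^ 2 * n / 2) := fun l' h => by
            rw [← h]; exact sum_exp_signs_le (hA i) l'
          calc ∑ w, |(b w i : ℝ)|
              ≤ ∑ w, Real.exp (-(r * B)) * (Real.exp (r * Y i w) + Real.exp (r * (-Y i w))) :=
                Finset.sum_le_sum fun w _ => abs_round_le_exp hB hr
            _ = Real.exp (-(r * B)) * (∑ w, Real.exp (r * Y i w) + ∑ w, Real.exp ((-r) * Y i w)) := by
                rw [← Finset.mul_sum, Finset.sum_add_distrib]; simp
            _ ≤ Real.exp (-(r * B)) * (2 ^ n * Real.exp (r ^ 2 * n / 2)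
                  + 2 ^ n * Real.exp (r ^ 2 * n / 2)) := by
                gcongr
                · exact hs r rfl
                · exact hs (-r) (by ring)
            _ = 2 ^ n * (2 * (Real.exp (-(r * B)) * Real.exp (r ^ 2 * n / 2))) := by ring
            _ = 2 ^ n * (2 * e) := by
                rw [← Real.exp_add]; congr 3; simp only [r]; field_simp; ring
      _ = _ := by simp; ring
  set c := l * (2 * m * e)
  have hjensen : 2 ^ n * Real.exp (-c) ≤ ∑ w, W (b w) := by
    -- Jensen's inequality in tangent-line form, taken at `c`, an upper bound for `l` times the mean
    -- of `∑ i, |b w i|`.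
    have hW : ∀ w, Real.exp (-c) * (1 + c - l * ∑ i, |(b w i : ℝ)|) ≤ W (b w) := fun w => by
      simp only [W]
      rw [← Real.exp_sum, Finset.sum_neg_distrib, ← Finset.mul_sum]
      have h1 := Real.add_one_le_exp (c - l * ∑ i, |(b w i : ℝ)|)
      calc _ ≤ Real.exp (-c) * Real.exp (c - l * ∑ i, |(b w i : ℝ)|) := by gcongr; linarith
        _ = _ := by rw [← Real.exp_add]; congr 1; ring
    refine le_trans ?_ (Finset.sum_le_sum fun w _ => hW w)
    rw [← Finset.mul_sum, Finset.sum_sub_distrib, ← Finset.mul_sum]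
    simp only [Finset.sum_const, Finset.card_univ, Fintype.card_fun, Fintype.card_bool,
      Fintype.card_fin, nsmul_eq_mul]
    push_cast
    have : l * ∑ w, ∑ i, |(b w i : ℝ)| ≤ 2 ^ n * c := by
      calc _ ≤ l * (2 ^ n * (2 * m * e)) := by gcongr
        _ = _ := by simp only [c]; ring
    have h2 := Real.exp_pos (-c)
    nlinarith
  have hZ : ∑ k ∈ U, W k ≤ Real.exp (4 * m * Real.exp (-l)) := by
    have h := Finset.prod_univ_sum (fun i : Fin m => Finset.univ.image fun w => b w i)
      (fun _ k => Real.exp (-(l * |(k : ℝ)|)))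
    simp only [U, W]
    rw [← h]
    calc _ ≤ ∏ i : Fin m, Real.exp (4 * Real.exp (-l)) :=
          Finset.prod_le_prod (fun i _ => Finset.sum_nonneg fun _ _ => (Real.exp_pos _).le)
            fun i _ => sum_exp_neg_abs_int_le hl _
      _ = _ := by rw [Finset.prod_const, ← Real.exp_nat_mul]; simp; ring_nf
  have hmem : ∀ w ∈ (Finset.univ : Finset (Fin n → Bool)), b w ∈ U := fun w _ => by
    simp only [U, Fintype.mem_piFinset, Finset.mem_image]
    exact fun i => ⟨w, Finset.mem_univ _, rfl⟩
  have hfib : ∑ w, W (b w)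
      = ∑ k ∈ U, ((Finset.univ.filter fun w => b w = k).card : ℝ) * W k := by
    rw [← Finset.sum_fiberwise_of_maps_to hmem]
    refine Finset.sum_congr rfl fun k _ => ?_
    rw [Finset.sum_congr rfl (g := fun _ => W k) fun w hw => by rw [(Finset.mem_filter.1 hw).2]]
    simp
  by_contra hcon
  push Not at hcon
  have hsmall : ∀ k, ((Finset.univ.filter fun w => b w = k).card : ℝ)
      < 2 ^ n * Real.exp (-(c + 4 * m * Real.exp (-l))) := by
    intro k
    by_contra hk
    push Not at hk
    obtain ⟨w, hw, w', hw', i, hi⟩ := hcon _ hk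
    have e1 : b w i = k i := by rw [(Finset.mem_filter.1 hw).2]
    have e2 : b w' i = k i := by rw [(Finset.mem_filter.1 hw').2]
    have a1 := abs_sub_round (Y i w / (2 * B))
    have a2 := abs_sub_round (Y i w' / (2 * B))
    rw [show round (Y i w / (2 * B)) = k i from e1] at a1
    rw [show round (Y i w' / (2 * B)) = k i from e2] at a2
    have a3 : |Y i w / (2 * B) - Y i w' / (2 * B)| ≤ 1 := by
      rw [abs_le] at *
      constructor <;> linarith [a1.1, a1.2, a2.1, a2.2]
    rw [← sub_div, abs_div, abs_of_pos (show 0 < 2 * B by positivity),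
      div_le_one (by positivity)] at a3
    exact absurd a3 (not_le.2 hi)
  have hUne : U.Nonempty := ⟨_, hmem (fun _ => true) (Finset.mem_univ _)⟩
  have hWpos : ∀ k, 0 < W k := fun k => Finset.prod_pos fun _ _ => Real.exp_pos _
  have : ∑ w, W (b w) < 2 ^ n * Real.exp (-c) := by
    calc _ = ∑ k ∈ U, ((Finset.univ.filter fun w => b w = k).card : ℝ) * W k := hfib
      _ < ∑ k ∈ U, 2 ^ n * Real.exp (-(c + 4 * m * Real.exp (-l))) * W k :=
        Finset.sum_lt_sum_of_nonempty hUne fun k _ => mul_lt_mul_of_pos_right (hsmall k) (hWpos k)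
      _ = 2 ^ n * Real.exp (-(c + 4 * m * Real.exp (-l))) * ∑ k ∈ U, W k := by
        rw [Finset.mul_sum]
      _ ≤ 2 ^ n * Real.exp (-(c + 4 * m * Real.exp (-l))) * Real.exp (4 * m * Real.exp (-l)) := by
        gcongr
      _ = _ := by rw [mul_assoc, ← Real.exp_add]; congr 2; ring
  linarith

/-- Each of the two entropy losses is made at most `δ n / 2`. With `q = m / n + 2`, taking `exp (-l)
= δ / (8 q)` handles `4 m exp (-l)`. A large `K` makes the Gaussian tail at most `q⁻² 2⁻ᵏ`, which
absorbs the factors `m ≤ n q` and `l ≤ 8 q / δ`. -/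
theorem exists_large_class_of_log (δ : ℝ) (hδ : 0 < δ) (hδ' : δ ≤ 1) : ∃ K₀ : ℝ, ∀ K : ℝ, K₀ ≤ K →
    ∀ (m n : ℕ) (A : Matrix (Fin m) (Fin n) ℝ), 1 ≤ n → (∀ i j, |A i j| ≤ 1) →
    ∃ T : Finset (Fin n → Bool), 2 ^ n * Real.exp (-(δ * n)) ≤ T.card ∧
      ∀ w ∈ T, ∀ w' ∈ T, ∀ i, |∑ j, A i j * boolSign (w j) - ∑ j, A i j * boolSign (w' j)|
        ≤ 2 * (K * √(n * Real.log (m / n + 2))) := by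
  -- Chosen so that `2 ^ (-k) ≤ δ ^ 2 / 32`.
  set k := |Real.log (32 / δ ^ 2) / Real.log 2|
  have hk0 : 0 ≤ k := abs_nonneg _
  have hlog2 : 1 / 2 < Real.log 2 := by have := Real.log_two_gt_d9; linarith
  have hk : 2 * (8 / δ) * Real.exp (-(k * Real.log 2)) ≤ δ / 2 := by
    have h1 : Real.log (32 / δ ^ 2) ≤ k * Real.log 2 := by
      rw [← div_le_iff₀ (by linarith)]; exact le_abs_self _
    have h2 : Real.exp (-(k * Real.log 2)) ≤ (32 / δ ^ 2)⁻¹ := by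
      rw [← Real.exp_log (show 0 < 32 / δ ^ 2 by positivity), ← Real.exp_neg, Real.exp_le_exp]
      linarith
    calc _ ≤ 2 * (8 / δ) * (32 / δ ^ 2)⁻¹ := by gcongr
      _ = δ / 2 := by field_simp; norm_num
  refine ⟨4 + 2 * k, fun K hK m n A hn hA => ?_⟩
  have hn' : (0 : ℝ) < n := by exact_mod_cast hn
  set q : ℝ := m / n + 2 with hq
  have hq2 : 2 ≤ q := by
    have : (0 : ℝ) ≤ m / n := by positivity
    linarith
  have hmq : (m : ℝ) ≤ n * q := by
    rw [hq, mul_add, mul_div_cancel₀ _ hn'.ne']; linarith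
  have hlq : Real.log 2 ≤ Real.log q := Real.log_le_log (by norm_num) hq2
  have hB2 : (K * √(n * Real.log q)) ^ 2 = K ^ 2 * (n * Real.log q) := by
    rw [mul_pow, Real.sq_sqrt (mul_nonneg hn'.le (by linarith))]
  have hKsq : 2 * (2 + k) ≤ K ^ 2 := by nlinarith
  have hB : 0 < K * √(n * Real.log q) :=
    mul_pos (by linarith) (Real.sqrt_pos.2 (mul_pos hn' (by linarith)))
  have hel : Real.exp (-Real.log (q * (8 / δ))) = δ / (8 * q) := by
    rw [Real.exp_neg, Real.exp_log (by positivity)]; field_simp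
  have h8 : 1 ≤ 8 / δ := by rw [le_div_iff₀ hδ]; linarith
  have hl0 : 0 ≤ Real.log (q * (8 / δ)) := Real.log_nonneg (by nlinarith)
  obtain ⟨T, hT, hT'⟩ := exists_large_class hn hA hB (l := Real.log (q * (8 / δ)))
    (by rw [hB2]
        have h2 : 1 ≤ K ^ 2 * Real.log q := by nlinarith
        nlinarith) hl0
    (by rw [hel, div_le_div_iff₀ (by positivity) (by positivity)]; linarith)
  refine ⟨T, le_trans ?_ hT, hT'⟩
  gcongr
  rw [hel]
  have h1 : 4 * (m : ℝ) * (δ / (8 * q)) ≤ δ / 2 * n := by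
    calc _ ≤ 4 * (n * q) * (δ / (8 * q)) := by gcongr
      _ = _ := by field_simp; norm_num
  have h2 : Real.exp (-((K * √(n * Real.log q)) ^ 2 / (2 * n)))
      ≤ (q ^ 2)⁻¹ * Real.exp (-(k * Real.log 2)) := by
    have e1 : (q ^ 2)⁻¹ = Real.exp (-(2 * Real.log q)) := by
      rw [Real.exp_neg, mul_comm, Real.exp_mul, Real.exp_log (by positivity)]; norm_num
    rw [e1, ← Real.exp_add, Real.exp_le_exp, hB2]
    have e2 : K ^ 2 * (n * Real.log q) / (2 * n) = K ^ 2 / 2 * Real.log q := by field_simp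
    rw [e2]
    nlinarith
  have h3 : Real.log (q * (8 / δ)) ≤ q * (8 / δ) := (Real.log_le_sub_one_of_pos (by positivity)).trans (by linarith)
  have h4 : Real.log (q * (8 / δ)) *
      (2 * m * Real.exp (-((K * √(n * Real.log q)) ^ 2 / (2 * n)))) ≤ δ / 2 * n := by
    calc _ ≤ q * (8 / δ) * (2 * (n * q) * ((q ^ 2)⁻¹ * Real.exp (-(k * Real.log 2)))) := by gcongr
      _ = 2 * (8 / δ) * Real.exp (-(k * Real.log 2)) * n := by field_simp
      _ ≤ _ := by gcongr
  linarith

/-! ### Small coordinate sets and the perturbing direction. -/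

/-- The number of small subsets of an `n`-element set is at most `exp (c n)`. -/
theorem exists_card_small_subsets_le (c : ℝ) (hc : 0 < c) : ∃ η : ℝ, 0 < η ∧ ∀ n : ℕ,
    ((Finset.univ.filter fun S : Finset (Fin n) => (S.card : ℝ) < η * n).card : ℝ)
      ≤ Real.exp (c * n) := by
  set r := min (c / 2) (1 / 2)
  have hr0 : 0 < r := by positivity
  have hrc : r ≤ c / 2 := min_le_left _ _
  have hr1 : r < 1 := (min_le_right _ _).trans_lt (by norm_num)
  have hL : 0 < -Real.log r := by have := Real.log_neg hr0 hr1; linarith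
  refine ⟨c / 2 / (-Real.log r), by positivity, fun n => ?_⟩
  set F := Finset.univ.filter fun S : Finset (Fin n) => (S.card : ℝ) < c / 2 / (-Real.log r) * n
  have h1 : (F.card : ℝ) * Real.exp (-(c / 2 * n)) ≤ (1 + r) ^ n := by
    calc (F.card : ℝ) * Real.exp (-(c / 2 * n)) = ∑ S ∈ F, Real.exp (-(c / 2 * n)) := by simp
      _ ≤ ∑ S ∈ F, r ^ S.card := by
        refine Finset.sum_le_sum fun S hS => ?_
        have h2 := (Finset.mem_filter.1 hS).2
        rw [← Real.exp_log hr0, ← Real.exp_nat_mul, Real.exp_le_exp]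
        rw [div_mul_eq_mul_div, lt_div_iff₀ hL] at h2
        linarith
      _ ≤ ∑ S : Finset (Fin n), r ^ S.card :=
        Finset.sum_le_sum_of_subset_of_nonneg (Finset.subset_univ _) fun _ _ _ => by positivity
      _ = (1 + r) ^ n := by
        have := Finset.sum_pow_mul_eq_add_pow r 1 (Finset.univ : Finset (Fin n))
        rw [Finset.powerset_univ] at this
        simpa [add_comm] using this
  have h2 : (1 + r) ^ n ≤ Real.exp (c / 2 * n) := by
    calc _ ≤ Real.exp (c / 2) ^ n := by
          refine pow_le_pow_left₀ (by positivity) ?_ n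
          have := Real.add_one_le_exp (c / 2); linarith
      _ = _ := by rw [← Real.exp_nat_mul]; ring_nf
  have h3 := h1.trans h2
  rw [Real.exp_neg, ← div_eq_mul_inv, div_le_iff₀ (Real.exp_pos _), ← Real.exp_add] at h3
  refine h3.trans (le_of_eq ?_)
  congr 1; ring

/-- For most sign patterns `s` and every small set `S` of coordinates, some `z` in the cube vanishes
on `S`, agrees with `s` in most coordinates, and `A z` is small. -/
theorem exists_sign_perturbation (t : ℝ) (ht : 0 < t) (ht' : t ≤ 1) :
    ∃ K η : ℝ, 0 < K ∧ 0 < η ∧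
    ∀ (m n : ℕ) (A : Matrix (Fin m) (Fin n) ℝ), 1 ≤ n → (∀ i j, |A i j| ≤ 1) →
    ∃ E : Finset (Fin n → Bool), 10 * (E.card : ℝ) ≤ 2 ^ n ∧
      ∀ s ∉ E, ∀ S : Finset (Fin n), (S.card : ℝ) < η * n → ∃ z : Fin n → ℝ,
        (∀ j, |z j| ≤ 1) ∧ (∀ j ∈ S, z j = 0) ∧
        (∀ i, |∑ j, A i j * z j| ≤ K * √(n * Real.log (m / n + 2))) ∧
        ∃ D : Finset (Fin n), (D.card : ℝ) ≤ S.card + 2 * (t * n) ∧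
          ∀ j ∉ D, z j = boolSign (s j) := by
  obtain ⟨K₀, hK₀⟩ := exists_large_class_of_log (t ^ 2 / 4) (by positivity) (by nlinarith)
  obtain ⟨η, hη, hcard⟩ := exists_card_small_subsets_le (t ^ 2 / 4) (by positivity)
  -- Below `N` the dimension is bounded, and the sign vector itself, zeroed on `S`, works since `|A
  -- z| ≤ n`. From `N` on, `exp (-t² n / 2) ≤ 1 / 20`.
  set N := 2 * Real.log 20 / t ^ 2
  have hN : 0 ≤ N := by have : 0 < Real.log 20 := Real.log_pos (by norm_num); positivity
  set K := max K₀ (2 * √N + 1)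
  have hK1 : 1 ≤ K := le_trans (by linarith [Real.sqrt_nonneg N]) (le_max_right _ _)
  refine ⟨K, η, by linarith, hη, fun m n A hn hA => ?_⟩
  have hn' : (0 : ℝ) < n := by exact_mod_cast hn
  have hA' : ∀ (S : Finset (Fin n)) i j, |Matrix.of (fun i j => if j ∈ S then 0 else A i j) i j| ≤ 1 := by
    intro S i j
    simp only [Matrix.of_apply]
    split_ifs
    · simp
    · exact hA i j
  rcases lt_or_ge (n : ℝ) N with hnN | hnN
  · refine ⟨∅, by simp, fun s _ S hS => ⟨fun j => if j ∈ S then 0 else boolSign (s j), ?_, ?_, ?_, S,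
      by have : 0 ≤ t * n := by positivity
         linarith, ?_⟩⟩
    · intro j; dsimp; split_ifs <;> simp
    · intro j hj; simp [hj]
    · intro i
      calc |∑ j, A i j * (if j ∈ S then 0 else boolSign (s j))| ≤ ∑ j : Fin n, (1 : ℝ) := by
            refine (Finset.abs_sum_le_sum_abs _ _).trans (Finset.sum_le_sum fun j _ => ?_)
            split_ifs
            · simp
            · simpa [abs_mul] using hA i j
        _ = n := by simp
        _ = √n * √n := (Real.mul_self_sqrt hn'.le).symm
        _ ≤ √N * (2 * √(n * Real.log (m / n + 2))) := by
            gcongr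
            rw [← Real.sqrt_sq (show (0 : ℝ) ≤ 2 by norm_num), ← Real.sqrt_mul (by norm_num)]
            refine Real.sqrt_le_sqrt ?_
            have h1 : Real.log 2 ≤ Real.log (m / n + 2) :=
              Real.log_le_log (by norm_num) (by have : (0 : ℝ) ≤ m / n := by positivity
                                                linarith)
            have := Real.log_two_gt_d9
            nlinarith
        _ = (2 * √N) * √(n * Real.log (m / n + 2)) := by ring
        _ ≤ K * √(n * Real.log (m / n + 2)) := by
            gcongr
            exact le_trans (by linarith) (le_max_right _ _)
    · intro j hj; simp [hj]
  choose T hT hTA using fun S : Finset (Fin n) =>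
    hK₀ K (le_max_left _ _) m n (Matrix.of fun i j => if j ∈ S then 0 else A i j) hn (hA' S)
  set far : Finset (Fin n) → Finset (Fin n → Bool) := fun S =>
    Finset.univ.filter fun s => ∀ w ∈ T S, t * n < (hammingDist s w : ℝ)
  set opp : (Fin n → Bool) → (Fin n → Bool) := fun s j => !(s j)
  have hopp : Function.Injective opp := fun s s' h => by
    ext j; have := congrFun h j; simpa [opp] using this
  set F := Finset.univ.filter fun S : Finset (Fin n) => (S.card : ℝ) < η * n
  have hfar : ∀ S, ((far S).card : ℝ) ≤ 2 ^ n * Real.exp (-(3 / 4 * t ^ 2 * n)) := by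
    intro S
    have h1 := card_far_mul_card_le (T S) ht.le
    have h2 : ((far S).card : ℝ) * (2 ^ n * Real.exp (-(t ^ 2 / 4 * n)))
        ≤ 4 ^ n * Real.exp (-(t ^ 2 * n)) :=
      (mul_le_mul_of_nonneg_left (hT S) (by positivity)).trans h1
    refine le_of_mul_le_mul_right (h2.trans (le_of_eq ?_))
      (show 0 < 2 ^ n * Real.exp (-(t ^ 2 / 4 * n)) by positivity)
    rw [show (4 : ℝ) = 2 * 2 by norm_num, mul_pow,
      show -(t ^ 2 * n) = -(3 / 4 * t ^ 2 * n) + -(t ^ 2 / 4 * n) by ring, Real.exp_add]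
    ring_nf
  refine ⟨F.biUnion fun S => far S ∪ Finset.univ.filter fun s => opp s ∈ far S, ?_, ?_⟩
  · have h1 : ((F.biUnion fun S => far S ∪ Finset.univ.filter fun s => opp s ∈ far S).card : ℝ)
        ≤ ∑ S ∈ F, 2 * (2 ^ n * Real.exp (-(3 / 4 * t ^ 2 * n))) := by
      refine le_trans (Nat.cast_le.2 Finset.card_biUnion_le) ?_
      push_cast
      refine Finset.sum_le_sum fun S _ => ?_
      have h2 : (Finset.univ.filter fun s => opp s ∈ far S).card ≤ (far S).card :=
        Finset.card_le_card_of_injOn opp (fun s hs => by simpa using hs) hopp.injOn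
      have h3 := Finset.card_union_le (far S) (Finset.univ.filter fun s => opp s ∈ far S)
      have h4 : ((far S ∪ Finset.univ.filter fun s => opp s ∈ far S).card : ℝ)
          ≤ 2 * (far S).card := by exact_mod_cast (by omega)
      linarith [hfar S]
    -- Of the concentration exponent `t² n`, one quarter pays for the size of `T S` and one quarter
    -- for the union bound over `S`. Half remains.
    have h5 : Real.exp (-(t ^ 2 / 2 * n)) ≤ 1 / 20 := by
      have : Real.log 20 ≤ t ^ 2 / 2 * n := by
        have h6 := (div_le_iff₀ (by positivity)).1 hnN
        linarith
      rw [show (1 : ℝ) / 20 = Real.exp (-Real.log 20) by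
        rw [Real.exp_neg, Real.exp_log (by norm_num)]; norm_num, Real.exp_le_exp]
      linarith
    calc _ ≤ 10 * ∑ S ∈ F, 2 * (2 ^ n * Real.exp (-(3 / 4 * t ^ 2 * n))) := by gcongr
      _ = F.card * (20 * 2 ^ n * Real.exp (-(3 / 4 * t ^ 2 * n))) := by simp; ring
      _ ≤ Real.exp (t ^ 2 / 4 * n) * (20 * 2 ^ n * Real.exp (-(3 / 4 * t ^ 2 * n))) := by
        gcongr; exact hcard n
      _ = 20 * 2 ^ n * Real.exp (-(t ^ 2 / 2 * n)) := by
        rw [show -(t ^ 2 / 2 * n) = t ^ 2 / 4 * n + -(3 / 4 * t ^ 2 * n) by ring, Real.exp_add]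
        ring
      _ ≤ 20 * 2 ^ n * (1 / 20) := by gcongr
      _ = 2 ^ n := by ring
  · intro s hs S hS
    have hSF : S ∈ F := by simp [F, hS]
    have h1 : s ∉ far S ∧ opp s ∉ far S := by
      by_contra hcon
      refine hs (Finset.mem_biUnion.2 ⟨S, hSF, ?_⟩)
      by_cases hf : s ∈ far S
      · exact Finset.mem_union_left _ hf
      · exact Finset.mem_union_right _ (Finset.mem_filter.2 ⟨Finset.mem_univ _, by tauto⟩)
    simp only [far, Finset.mem_filter, Finset.mem_univ, true_and] at h1
    push Not at h1
    obtain ⟨⟨w, hw, hsw⟩, w', hw', hsw'⟩ := h1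
    -- Where `w` agrees with `s` and `w'` with `-s`, half the difference is the sign of `s`; the
    -- common value of `A` on the class cancels.
    refine ⟨fun j => if j ∈ S then 0 else (boolSign (w j) - boolSign (w' j)) / 2, ?_, ?_, ?_,
      S ∪ ((Finset.univ.filter fun j => s j ≠ w j) ∪ Finset.univ.filter fun j => opp s j ≠ w' j),
      ?_, ?_⟩
    · intro j
      dsimp
      split_ifs
      · simp
      · cases w j <;> cases w' j <;> norm_num [boolSign]
    · intro j hj; simp [hj]
    · intro i
      have h2 := hTA S w hw w' hw' i
      rw [← Finset.sum_sub_distrib] at h2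
      have h3 : ∑ j, A i j * (if j ∈ S then 0 else (boolSign (w j) - boolSign (w' j)) / 2)
          = (∑ j, (Matrix.of (fun i j => if j ∈ S then 0 else A i j) i j * boolSign (w j)
            - Matrix.of (fun i j => if j ∈ S then 0 else A i j) i j * boolSign (w' j))) / 2 := by
        rw [Finset.sum_div]
        refine Finset.sum_congr rfl fun j _ => ?_
        simp only [Matrix.of_apply]
        split_ifs <;> ring
      rw [h3, abs_div, abs_two, div_le_iff₀ (by norm_num)]
      linarith
    · have h2 := Finset.card_union_le S ((Finset.univ.filter fun j => s j ≠ w j) ∪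
        Finset.univ.filter fun j => opp s j ≠ w' j)
      have h3 := Finset.card_union_le (Finset.univ.filter fun j => s j ≠ w j)
        (Finset.univ.filter fun j => opp s j ≠ w' j)
      have h4 := h2.trans (Nat.add_le_add_left h3 _)
      have h5 : ((S ∪ ((Finset.univ.filter fun j => s j ≠ w j) ∪
        Finset.univ.filter fun j => opp s j ≠ w' j)).card : ℝ)
        ≤ S.card + (hammingDist s w + hammingDist (opp s) w') := by exact_mod_cast h4
      linarith
    · intro j hj
      simp only [Finset.mem_union, Finset.mem_filter, Finset.mem_univ, true_and, not_or,
        not_not, opp] at hj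
      obtain ⟨hjS, h2, h3⟩ := hj
      simp only [hjS, if_false, ← h2, ← h3]
      cases s j <;> norm_num [boolSign]

/-! ### Gaussian estimates. -/

instance (n : ℕ) : IsProbabilityMeasure (gaussianVector n) := by
  unfold gaussianVector; infer_instance

theorem integral_exp_mul_sq_gaussianReal :
    ∫ x, Real.exp (3 / 8 * x ^ 2) ∂(gaussianReal 0 1) = 2 := by
  rw [integral_gaussianReal_eq_integral_smul one_ne_zero]
  have h : ∀ x : ℝ, gaussianPDFReal 0 1 x • Real.exp (3 / 8 * x ^ 2)
      = (√(2 * Real.pi))⁻¹ * Real.exp (-(1 / 8) * x ^ 2) := fun x => by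
    simp only [gaussianPDFReal, NNReal.coe_one, smul_eq_mul, mul_one]
    rw [mul_assoc, ← Real.exp_add]
    congr 2; ring
  simp_rw [h]
  rw [integral_const_mul, integral_gaussian, ← Real.sqrt_inv, ← Real.sqrt_mul (by positivity)]
  rw [show (2 * Real.pi)⁻¹ * (Real.pi / (1 / 8)) = 2 ^ 2 by field_simp; norm_num]
  exact Real.sqrt_sq (by norm_num)

/-- Chernoff bound with exponent `3 / 8`, for which each coordinate has exponential moment exactly
`2`: the tail is at most `2 ^ n * exp (-3 n / 2)`, and `2 ≤ e`. -/
theorem gaussianVector_norm_tail {n : ℕ} (hn : 1 ≤ n) :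
    (gaussianVector n).real {g | ‖WithLp.toLp 2 g‖ ≤ 2 * √n}ᶜ ≤ Real.exp (-(1 / 2 * n)) := by
  have hint : ∫ g, ∏ j, Real.exp (3 / 8 * g j ^ 2) ∂(gaussianVector n) = 2 ^ n := by
    unfold gaussianVector
    rw [integral_fintype_prod_eq_prod (𝕜 := ℝ) (fun _ x => Real.exp (3 / 8 * x ^ 2))]
    simp [integral_exp_mul_sq_gaussianReal]
  have hi : Integrable (fun g : Fin n → ℝ => ∏ j, Real.exp (3 / 8 * g j ^ 2)) (gaussianVector n) := by
    -- A non-integrable function has integral `0` by convention, so the nonzero value just computed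
    -- proves integrability.
    by_contra h
    rw [integral_undef h] at hint
    exact absurd hint.symm (by positivity)
  have h := mul_meas_ge_le_integral_of_nonneg
    (Filter.Eventually.of_forall fun g => Finset.prod_nonneg fun j _ => (Real.exp_pos _).le) hi
    (Real.exp (3 / 2 * n))
  rw [hint] at h
  have hsub : {g : Fin n → ℝ | ‖WithLp.toLp 2 g‖ ≤ 2 * √n}ᶜ
      ⊆ {g | Real.exp (3 / 2 * n) ≤ ∏ j, Real.exp (3 / 8 * g j ^ 2)} := by
    intro g hg
    simp only [Set.mem_compl_iff, Set.mem_ofPred_eq, not_le] at hg ⊢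
    rw [← Real.exp_sum, Real.exp_le_exp, ← Finset.mul_sum]
    have h1 : (2 * √n) ^ 2 < ‖WithLp.toLp 2 g‖ ^ 2 := by gcongr
    rw [EuclideanSpace.real_norm_sq_eq, mul_pow, Real.sq_sqrt (by positivity)] at h1
    simp only at h1
    linarith
  have h2 := measureReal_mono (μ := gaussianVector n) hsub
  have h3 : (gaussianVector n).real {g | Real.exp (3 / 2 * n) ≤ ∏ j, Real.exp (3 / 8 * g j ^ 2)}
      ≤ 2 ^ n * Real.exp (-(3 / 2 * n)) := by
    rw [Real.exp_neg, ← div_eq_mul_inv, le_div_iff₀ (Real.exp_pos _), mul_comm]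
    exact h
  have h4 : (2 : ℝ) ^ n ≤ Real.exp n := by
    rw [← Real.exp_one_pow]
    exact pow_le_pow_left₀ (by norm_num) (by have := Real.exp_one_gt_d9; linarith) n
  calc _ ≤ _ := h2.trans h3
    _ ≤ Real.exp n * Real.exp (-(3 / 2 * n)) := by gcongr
    _ = _ := by rw [← Real.exp_add]; congr 1; ring

theorem integral_gaussianVector_eval {n : ℕ} (j : Fin n) {f : ℝ → ℝ} (hf : Measurable f) :
    ∫ g, f (g j) ∂(gaussianVector n) = ∫ x, f x ∂(gaussianReal 0 1) := by
  have h := measurePreserving_eval (fun _ : Fin n => gaussianReal 0 1) j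
  rw [← h.map_eq, integral_map h.measurable.aemeasurable hf.aestronglyMeasurable]
  rfl

theorem integrable_gaussianVector_eval {n : ℕ} (j : Fin n) {f : ℝ → ℝ}
    (hf : Integrable f (gaussianReal 0 1)) :
    Integrable (fun g => f (g j)) (gaussianVector n) :=
  (measurePreserving_eval (fun _ : Fin n => gaussianReal 0 1) j).integrable_comp_of_integrable hf

/-- A failure probability small for every `n`; the exponential tail is too weak when `n` is small.
-/
theorem gaussianVector_sum_sq_markov (n : ℕ) (hn : 1 ≤ n) :
    (gaussianVector n).real {g | 25 * (n : ℝ) ≤ ∑ j, g j ^ 2} ≤ 1 / 25 := by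
  have hn' : (0 : ℝ) < n := by exact_mod_cast hn
  have hsq : ∫ x, x ^ 2 ∂(gaussianReal 0 1) = 1 := by
    have h := variance_fun_id_gaussianReal (μ := 0) (v := 1)
    rw [variance_eq_integral (by fun_prop)] at h
    simpa using h
  have hi : Integrable (fun x : ℝ => x ^ 2) (gaussianReal 0 1) := by
    by_contra h
    rw [integral_undef h] at hsq
    norm_num at hsq
  have h := mul_meas_ge_le_integral_of_nonneg (μ := gaussianVector n)
    (f := fun g => ∑ j, g j ^ 2)
    (Filter.Eventually.of_forall fun g => Finset.sum_nonneg fun j _ => sq_nonneg _)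
    (integrable_finsetSum _ fun j _ => integrable_gaussianVector_eval j hi) (25 * n)
  rw [integral_finsetSum _ fun j _ => integrable_gaussianVector_eval j hi] at h
  simp_rw [integral_gaussianVector_eval (f := fun x => x ^ 2) _ (by fun_prop), hsq] at h
  simp only [Finset.sum_const, Finset.card_univ, Fintype.card_fin, nsmul_eq_mul, mul_one] at h
  change 25 * (n : ℝ) * (gaussianVector n).real _ ≤ n at h
  rw [le_div_iff₀ (by norm_num)]
  nlinarith

theorem gaussianReal_small_ball {t : ℝ} (ht : 0 ≤ t) :
    (gaussianReal 0 1).real (Set.Ioo (-t) t) ≤ t := by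
  rw [measureReal_def, gaussianReal_apply_eq_integral 0 one_ne_zero,
    ENNReal.toReal_ofReal (integral_nonneg fun x => gaussianPDFReal_nonneg _ _ _)]
  have hb : ∀ x, gaussianPDFReal 0 1 x ≤ 1 / 2 := fun x => by
    simp only [gaussianPDFReal, NNReal.coe_one, mul_one]
    have h1 : (√(2 * Real.pi))⁻¹ ≤ 1 / 2 := by
      rw [inv_eq_one_div]
      refine one_div_le_one_div_of_le (by norm_num) (Real.le_sqrt_of_sq_le ?_)
      have := Real.pi_gt_three; linarith
    have h2 : Real.exp (-(x - 0) ^ 2 / 2) ≤ 1 := by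
      rw [Real.exp_le_one_iff]; nlinarith [sq_nonneg (x - 0)]
    calc _ ≤ 1 / 2 * 1 := mul_le_mul h1 h2 (Real.exp_pos _).le (by norm_num)
      _ = _ := by ring
  calc ∫ x in Set.Ioo (-t) t, gaussianPDFReal 0 1 x
      ≤ ∫ x in Set.Ioo (-t) t, (1 / 2 : ℝ) :=
        integral_mono (integrable_gaussianPDFReal 0 1).integrableOn (by simp) hb
    _ = t := by simp [ht]; ring

theorem gaussianVector_card_small_markov (n : ℕ) (hn : 1 ≤ n) {t : ℝ} (ht : 0 ≤ t) :
    (gaussianVector n).real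
      {g | (n : ℝ) / 2 ≤ ∑ j, Set.indicator (Set.Ioo (-t) t) 1 (g j)} ≤ 2 * t := by
  have hn' : (0 : ℝ) < n := by exact_mod_cast hn
  have hi : Integrable (Set.indicator (Set.Ioo (-t) t) (1 : ℝ → ℝ)) (gaussianReal 0 1) :=
    (integrable_const (1 : ℝ)).indicator measurableSet_Ioo
  have h := mul_meas_ge_le_integral_of_nonneg (μ := gaussianVector n)
    (f := fun g => ∑ j, Set.indicator (Set.Ioo (-t) t) (1 : ℝ → ℝ) (g j))
    (Filter.Eventually.of_forall fun g => Finset.sum_nonneg fun j _ =>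
      Set.indicator_nonneg (fun _ _ => zero_le_one) _)
    (integrable_finsetSum _ fun j _ => integrable_gaussianVector_eval j hi) (n / 2)
  rw [integral_finsetSum _ fun j _ => integrable_gaussianVector_eval j hi] at h
  simp_rw [integral_gaussianVector_eval (f := Set.indicator (Set.Ioo (-t) t) 1) _
    (measurable_one.indicator measurableSet_Ioo), integral_indicator_one measurableSet_Ioo] at h
  simp only [Finset.sum_const, Finset.card_univ, Fintype.card_fin, nsmul_eq_mul] at h
  have h1 := gaussianReal_small_ball ht
  change (n : ℝ) / 2 * (gaussianVector n).real _ ≤ _ at h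
  have h2 := h.trans (mul_le_mul_of_nonneg_left h1 hn'.le)
  refine le_of_mul_le_mul_left ?_ (show (0 : ℝ) < n / 2 by positivity)
  linarith

/-- The sign pattern of a vector. -/
noncomputable def signPattern {n : ℕ} (g : Fin n → ℝ) : Fin n → Bool := fun j => decide (0 ≤ g j)

theorem gaussianReal_half_lines :
    gaussianReal 0 1 (Set.Ici 0) = 1 / 2 ∧ gaussianReal 0 1 (Set.Iio 0) = 1 / 2 := by
  have := nullSingletonClass_gaussianReal (μ := 0) (v := 1) one_ne_zero
  have h1 : gaussianReal 0 1 (Set.Iio 0) = gaussianReal 0 1 (Set.Ici 0) := by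
    have h := gaussianReal_map_neg (μ := 0) (v := 1)
    rw [neg_zero] at h
    rw [← measure_congr (Ioi_ae_eq_Ici (μ := gaussianReal 0 1) (a := (0 : ℝ)))]
    conv_lhs => rw [← h]
    rw [Measure.map_apply measurable_neg measurableSet_Iio]
    congr 1
    ext x; simp
  have h2 : gaussianReal 0 1 (Set.Iio 0) + gaussianReal 0 1 (Set.Ici 0) = 1 := by
    have h := measure_add_measure_compl (μ := gaussianReal 0 1) (measurableSet_Iio (a := (0 : ℝ)))
    rwa [Set.compl_Iio, measure_univ] at h
  rw [h1, ← two_mul] at h2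
  have h3 : gaussianReal 0 1 (Set.Ici 0) = 1 / 2 := by
    rw [ENNReal.eq_div_iff (by simp) (by simp)]; exact h2
  exact ⟨h3, h1.trans h3⟩

theorem gaussianVector_signPattern_eq {n : ℕ} (s : Fin n → Bool) :
    gaussianVector n {g | signPattern g = s} = (1 / 2) ^ n := by
  have h : {g : Fin n → ℝ | signPattern g = s}
      = Set.univ.pi fun j => if s j then Set.Ici 0 else Set.Iio 0 := by
    ext g
    simp only [Set.mem_ofPred_eq, signPattern, funext_iff, Set.mem_univ_pi]
    refine forall_congr' fun j => ?_
    cases s j <;> simp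
  rw [h, gaussianVector, Measure.pi_pi]
  have : ∀ j, gaussianReal 0 1 (if s j then Set.Ici 0 else Set.Iio 0) = 1 / 2 := fun j => by
    cases s j
    · simpa using gaussianReal_half_lines.2
    · simpa using gaussianReal_half_lines.1
  simp [this]

theorem gaussianVector_signPattern_mem {n : ℕ} (E : Finset (Fin n → Bool)) :
    (gaussianVector n).real {g | signPattern g ∈ E} ≤ E.card / 2 ^ n := by
  have h : {g : Fin n → ℝ | signPattern g ∈ E} = ⋃ s ∈ E, {g | signPattern g = s} := by
    ext g; simp
  rw [h]
  refine (measureReal_biUnion_finset_le _ _).trans ?_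
  simp only [measureReal_def, gaussianVector_signPattern_eq]
  simp [div_eq_mul_inv]

/-! ### Deterministic inequalities and the improvement argument. -/

theorem sum_abs_subset_le {n : ℕ} {g : Fin n → ℝ} (D : Finset (Fin n)) {G d : ℝ} (hd : 0 ≤ d)
    (hG : ∑ j, g j ^ 2 ≤ G) (hD : (D.card : ℝ) ≤ d) : (∑ j ∈ D, |g j|) ^ 2 ≤ d * G := by
  calc (∑ j ∈ D, |g j|) ^ 2 ≤ D.card * ∑ j ∈ D, |g j| ^ 2 := sq_sum_le_card_mul_sum_sq
    _ ≤ d * ∑ j, g j ^ 2 := by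
      gcongr with j
      simp only [sq_abs]
      exact Finset.sum_le_sum_of_subset_of_nonneg (Finset.subset_univ _) fun _ _ _ => sq_nonneg _
    _ ≤ _ := by gcongr

theorem sum_abs_ge {n : ℕ} {g : Fin n → ℝ} {t : ℝ} (ht : 0 ≤ t)
    (h : ∑ j, Set.indicator (Set.Ioo (-t) t) (1 : ℝ → ℝ) (g j) ≤ n / 2) :
    t * n / 2 ≤ ∑ j, |g j| := by
  have h1 : ∑ j, t * (1 - Set.indicator (Set.Ioo (-t) t) (1 : ℝ → ℝ) (g j)) ≤ ∑ j, |g j| := by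
    refine Finset.sum_le_sum fun j _ => ?_
    by_cases hj : g j ∈ Set.Ioo (-t) t
    · simp [hj]
    · rw [Set.indicator_of_notMem hj, sub_zero, mul_one]
      by_contra hlt
      exact hj (abs_lt.1 (not_le.1 hlt))
  rw [← Finset.mul_sum, Finset.sum_sub_distrib] at h1
  simp at h1 h
  nlinarith

/-- A vector in the cube that matches the sign pattern of `g` in most coordinates has a large inner
product with `g`. -/
theorem dotProduct_ge_of_signs {n : ℕ} {g z : Fin n → ℝ} {D : Finset (Fin n)}
    (hsq : ∑ j, g j ^ 2 ≤ 25 * n) (habs : (n : ℝ) / 80 ≤ ∑ j, |g j|) (hz : ∀ j, |z j| ≤ 1)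
    (hD : (D.card : ℝ) ≤ 3 / 10 ^ 7 * n) (hzD : ∀ j ∉ D, z j = boolSign (signPattern g j)) :
    (n : ℝ) / 160 ≤ g ⬝ᵥ z := by
  have h1 : ∑ j, |g j| - 2 * ∑ j ∈ D, |g j| ≤ g ⬝ᵥ z := by
    have h2 : ∑ j ∈ D, |g j| = ∑ j, if j ∈ D then |g j| else 0 := by simp
    rw [h2, Finset.mul_sum, ← Finset.sum_sub_distrib]
    refine Finset.sum_le_sum fun j _ => ?_
    by_cases hj : j ∈ D
    · simp only [hj, if_true]
      have : |g j * z j| ≤ |g j| := by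
        rw [abs_mul]; exact mul_le_of_le_one_right (abs_nonneg _) (hz j)
      linarith [neg_abs_le (g j * z j)]
    · simp only [hj, if_false, hzD j hj]
      by_cases h0 : 0 ≤ g j
      · simp [signPattern, boolSign, h0, abs_of_nonneg]
      · simp [signPattern, boolSign, h0, abs_of_neg (not_le.1 h0)]
  have h3 := sum_abs_subset_le D (by positivity) hsq hD
  -- Cauchy–Schwarz gives `25 * 3 / 10 ^ 7 ≤ (1 / 320) ^ 2`, which fixes the size allowed for `D`.
  have h4 : ∑ j ∈ D, |g j| ≤ n / 320 := by
    refine abs_le_of_sq_le_sq' (h3.trans ?_) (by positivity) |>.2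
    nlinarith [sq_nonneg (n : ℝ)]
  linarith

theorem dotProduct_le_of_sum_sq {n : ℕ} {g x : Fin n → ℝ} (hsq : ∑ j, g j ^ 2 ≤ 25 * n)
    (hx : ‖x‖ ≤ 1) : g ⬝ᵥ x ≤ 5 * n := by
  have h3 := sum_abs_subset_le Finset.univ (d := n) (by positivity) hsq (by simp)
  have h4 : ∑ j, |g j| ≤ 5 * n := by
    refine abs_le_of_sq_le_sq' (h3.trans (le_of_eq ?_)) (by positivity) |>.2
    ring
  refine le_trans (Finset.sum_le_sum fun j _ => ?_) h4
  refine (le_abs_self _).trans ?_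
  rw [abs_mul]
  exact mul_le_of_le_one_right (abs_nonneg _) ((norm_le_pi_norm x j).trans hx)

/-- If every small set of coordinates admits a good direction `z`, then every near-optimal point has
many coordinates close to `±1`: otherwise a rescaling of `x + ε z` would beat the optimum. -/
theorem card_large_coords_of_near_optimal {m n : ℕ} (hn : 1 ≤ n) {A : Matrix (Fin m) (Fin n) ℝ}
    {g : Fin n → ℝ} {K η c ε : ℝ} (hK : 0 < K) (hη : η ≤ 1 / 320)
    (hc : 320 * 6 * K ≤ c) (hε0 : 0 < ε) (hε1 : ε ≤ 1) (hsq : ∑ j, g j ^ 2 ≤ 25 * n)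
    (hz : ∀ S : Finset (Fin n), (S.card : ℝ) < η * n → ∃ z : Fin n → ℝ,
      (∀ j, |z j| ≤ 1) ∧ (∀ j ∈ S, z j = 0) ∧
      (∀ i, |∑ j, A i j * z j| ≤ K * √(n * Real.log (m / n + 2))) ∧ (n : ℝ) / 160 ≤ g ⬝ᵥ z)
    {x : Fin n → ℝ} (hx : x ∈ feasibleRegion A c)
    (hopt : lpOpt A c g - ε * η * √n ≤ g ⬝ᵥ x / √n) :
    η * n ≤ (Finset.card {j : Fin n | 1 - ε ≤ |x j|} : ℝ) := by
  by_contra hcon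
  push Not at hcon
  obtain ⟨z, hz1, hz0, hAz, hgz⟩ := hz _ hcon
  have hn' : (0 : ℝ) < n := by exact_mod_cast hn
  have hsn : 0 < √(n : ℝ) := Real.sqrt_pos.2 hn'
  have hc0 : 0 < c := by linarith
  have hεK : 0 < ε * K := by positivity
  set L := √(n * Real.log (m / n + 2))
  have hL : 0 ≤ L := Real.sqrt_nonneg _
  obtain ⟨hxA, hx1⟩ := hx
  -- Needed because the real `sSup` of an unbounded set is `0`.
  have hbdd : BddAbove ((fun y => g ⬝ᵥ y / √n) '' feasibleRegion A c) := by
    refine ⟨5 * n / √n, ?_⟩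
    rintro _ ⟨y, hy, rfl⟩
    exact div_le_div_of_nonneg_right (dotProduct_le_of_sum_sq hsq hy.2) hsn.le
  set y : Fin n → ℝ := x + ε • z with hy
  set r := c / (c + ε * K)
  have hr0 : 0 ≤ r := by positivity
  have hr1 : r ≤ 1 := by rw [div_le_one (by positivity)]; linarith
  have hy1 : ‖y‖ ≤ 1 := by
    rw [pi_norm_le_iff_of_nonneg zero_le_one]
    intro j
    have hxj : |x j| ≤ 1 := (norm_le_pi_norm x j).trans hx1
    simp only [hy, Pi.add_apply, Pi.smul_apply, smul_eq_mul, Real.norm_eq_abs]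
    by_cases hj : 1 - ε ≤ |x j|
    · rw [hz0 j (Finset.mem_filter.2 ⟨Finset.mem_univ _, hj⟩)]; simpa using hxj
    · have h1 := abs_add_le (x j) (ε * z j)
      rw [abs_mul, abs_of_pos hε0] at h1
      have := mul_le_mul_of_nonneg_left (hz1 j) hε0.le
      linarith
  have hyA : ‖A.mulVec y‖ ≤ (c + ε * K) * L := by
    rw [hy, Matrix.mulVec_add, Matrix.mulVec_smul]
    have hzA : ‖A.mulVec z‖ ≤ K * L :=
      (pi_norm_le_iff_of_nonneg (by positivity)).2 fun i => hAz i
    calc _ ≤ ‖A.mulVec x‖ + ‖ε • A.mulVec z‖ := norm_add_le _ _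
      _ ≤ c * L + ε * (K * L) := by
        rw [norm_smul, Real.norm_of_nonneg hε0.le]
        gcongr
      _ = _ := by ring
  have hmem : r • y ∈ feasibleRegion A c := by
    constructor
    · rw [Matrix.mulVec_smul, norm_smul, Real.norm_of_nonneg hr0]
      calc r * ‖A.mulVec y‖ ≤ r * ((c + ε * K) * L) := by gcongr
        _ = c * L := by simp only [r]; field_simp
    · rw [norm_smul, Real.norm_of_nonneg hr0]
      exact mul_le_one₀ hr1 (norm_nonneg _) hy1
  have hle : g ⬝ᵥ (r • y) / √n ≤ lpOpt A c g := le_csSup hbdd ⟨_, hmem, rfl⟩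
  have h1 : g ⬝ᵥ (r • y) / √n ≤ g ⬝ᵥ x / √n + ε * η * √n := by linarith
  rw [div_add' _ _ _ hsn.ne', div_le_div_iff_of_pos_right hsn, mul_assoc (ε * η),
    Real.mul_self_sqrt hn'.le, hy, dotProduct_smul, dotProduct_add, dotProduct_smul,
    smul_eq_mul, smul_eq_mul, div_mul_eq_mul_div, div_le_iff₀ (by positivity)] at h1
  have hgx := dotProduct_le_of_sum_sq hsq hx1
  have h2 : ε * (c * (n / 160)) ≤ ε * (c * (g ⬝ᵥ z)) := by gcongr
  have h3 : ε * (K * (g ⬝ᵥ x)) ≤ ε * (K * (5 * n)) := by gcongr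
  have h4 : ε * (c * (n / 160)) ≤ ε * (K * (5 * n) + η * n * (c + ε * K)) := by linarith
  -- After division by `ε` and use of `η ≤ 1 / 320`, what is left is `c / 320 ≤ 5 K + K / 320`,
  -- contradicting `c ≥ 320 * 6 * K`.
  have h5 := le_of_mul_le_mul_left h4 hε0
  have h6 : η * n * (c + ε * K) ≤ 1 / 320 * n * (c + 1 * K) := by gcongr
  have h7 : n * (320 * 6 * K) ≤ n * c := by gcongr
  have h8 : 0 < n * K := by positivity
  linarith

/-! ### Assembly of the probability bounds. -/

theorem one_sub_le_measureReal_of_compl_le {Ω : Type*} [MeasurableSpace Ω] {μ : Measure Ω}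
    [IsProbabilityMeasure μ] {s : Set Ω} {a : ℝ} (h : μ.real sᶜ ≤ a) : 1 - a ≤ μ.real s := by
  have h1 := measureReal_union_le (μ := μ) s sᶜ
  rw [Set.union_compl_self, probReal_univ] at h1
  linarith

/-- Only monotonicity is applied to `s`, so the event about near-optimal points need not be shown
measurable. -/
theorem uniformInterval_prod_ge {n : ℕ} {a b : ℝ} (hab : a < b) {G : Set (Fin n → ℝ)}
    {s : Set ((Fin n → ℝ) × ℝ)} (h : ∀ g ∈ G, ∀ c ∈ Set.Icc a b, (g, c) ∈ s) :
    (gaussianVector n).real G ≤ ((gaussianVector n).prod (uniformInterval a b)).real s := by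
  have h0 : volume (Set.Icc a b) ≠ 0 := by simp [hab]
  have : IsProbabilityMeasure (uniformInterval a b) :=
    cond_isProbabilityMeasure_of_finite h0 (by simp)
  have h1 : (uniformInterval a b).real (Set.Icc a b) = 1 := by
    rw [measureReal_def, uniformInterval, cond_apply_self h0 (by simp)]; rfl
  calc (gaussianVector n).real G
      = ((gaussianVector n).prod (uniformInterval a b)).real (G ×ˢ Set.Icc a b) := by
        rw [measureReal_prod_prod, h1, mul_one]
    _ ≤ _ := measureReal_mono fun p hp => h p.1 hp.1 p.2 hp.2

theorem one_lt_log_of_three_le {n : ℕ} (hn : 3 ≤ n) : 1 < Real.log n := by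
  rw [Real.lt_log_iff_exp_lt (by positivity)]
  have h : (3 : ℝ) ≤ n := by exact_mod_cast hn
  linarith [Real.exp_one_lt_d9]

theorem proposition2p3 :
    ∃ C η κ : ℝ, 0 < C ∧ 0 < η ∧ 0 < κ ∧
      ∀ (m n : ℕ) (A : Matrix (Fin m) (Fin n) ℝ), 1 ≤ n → oneToInftyNorm A ≤ 1 →
        1 - Real.exp (-(κ * n)) ≤
          ((gaussianVector n).prod (uniformInterval C (2 * C))).real
            {p | ‖WithLp.toLp 2 p.1‖ ≤ 2 * √n} ∧
        (2 ≤ n →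
          4 / 5 ≤ ((gaussianVector n).prod (uniformInterval C (2 * C))).real
            {p | ∀ x ∈ feasibleRegion A p.2,
              lpOpt A p.2 p.1 - 1 / Real.log n * η * √n ≤ p.1 ⬝ᵥ x / √n →
              η * n ≤ (Finset.card {j : Fin n | 1 - 1 / Real.log n ≤ |x j|} : ℝ)}) := by
  obtain ⟨K, η, hK, hη, hKη⟩ := exists_sign_perturbation (1 / 10 ^ 7) (by norm_num) (by norm_num)
  have hη' : min η (1 / 10 ^ 7) ≤ 1 / 10 ^ 7 := min_le_right _ _
  refine ⟨320 * 6 * K, min η (1 / 10 ^ 7), 1 / 2, by positivity, by positivity, by norm_num,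
    fun m n A hn hA => ⟨?_, fun hn2 => ?_⟩⟩
  · exact (one_sub_le_measureReal_of_compl_le (gaussianVector_norm_tail hn)).trans
      (uniformInterval_prod_ge (by linarith) fun g hg c _ => hg)
  have hn' : (0 : ℝ) < n := by exact_mod_cast hn
  obtain ⟨E, hE, hEz⟩ := hKη m n A hn ((oneToInftyNorm_le_one_iff A).1 hA)
  -- The three bad events have probability at most `1 / 25`, `1 / 20` and `1 / 10`, in total below
  -- `1 / 5`.
  set G : Set (Fin n → ℝ) := ({g | 25 * (n : ℝ) ≤ ∑ j, g j ^ 2} ∪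
    ({g | (n : ℝ) / 2 ≤ ∑ j, Set.indicator (Set.Ioo (-(1 / 40)) (1 / 40)) 1 (g j)} ∪
      {g | signPattern g ∈ E}))ᶜ with hG
  have hGm : (gaussianVector n).real Gᶜ ≤ 1 / 5 := by
    rw [hG, compl_compl]
    have h1 := gaussianVector_sum_sq_markov n hn
    have h2 := gaussianVector_card_small_markov n hn (t := 1 / 40) (by norm_num)
    have h3 : (gaussianVector n).real {g | signPattern g ∈ E} ≤ 1 / 10 := by
      refine (gaussianVector_signPattern_mem E).trans ?_
      rw [div_le_div_iff₀ (by positivity) (by norm_num)]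
      linarith
    refine (measureReal_union_le _ _).trans ?_
    have h4 := measureReal_union_le (μ := gaussianVector n)
      {g | (n : ℝ) / 2 ≤ ∑ j, Set.indicator (Set.Ioo (-(1 / 40)) (1 / 40)) 1 (g j)}
      {g | signPattern g ∈ E}
    linarith
  refine le_trans (by norm_num) ((one_sub_le_measureReal_of_compl_le hGm).trans
    (uniformInterval_prod_ge (by linarith) fun g hg c hc x hx hopt => ?_))
  dsimp only at hx hopt
  simp only [hG, Set.mem_compl_iff, Set.mem_union, Set.mem_ofPred_eq, not_or, not_le] at hg
  obtain ⟨hsq, hsmall, hgE⟩ := hg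
  -- For `n = 2`, `ε = 1 / log 2` exceeds `1`, so the threshold `1 - ε` is negative and every
  -- coordinate counts; the improvement argument needs `ε ≤ 1`.
  rcases Nat.lt_or_ge n 3 with h3 | h3
  · obtain rfl : n = 2 := by omega
    have hlog : 1 ≤ 1 / Real.log (2 : ℕ) := by
      have h1 := Real.log_two_lt_d9
      have h2 := Real.log_two_gt_d9
      push_cast
      rw [le_div_iff₀ (by linarith)]
      linarith
    rw [Finset.filter_true_of_mem fun j _ => by linarith [abs_nonneg (x j)]]
    simp only [Finset.card_univ, Fintype.card_fin]
    push_cast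
    linarith
  · have hlog := one_lt_log_of_three_le h3
    refine card_large_coords_of_near_optimal hn hK (by linarith) hc.1
      (by positivity) (by rw [div_le_one (by linarith)]; exact hlog.le) hsq.le
      (fun S hS => ?_) hx hopt
    obtain ⟨z, hz1, hz0, hAz, D, hD, hzD⟩ := hEz _ hgE S
      (hS.trans_le (mul_le_mul_of_nonneg_right (min_le_left _ _) hn'.le))
    refine ⟨z, hz1, hz0, hAz, dotProduct_ge_of_signs hsq.le ?_ hz1 ?_ hzD⟩
    · have := sum_abs_ge (g := g) (t := 1 / 40) (by norm_num) hsmall.le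
      linarith
    · have : min η (1 / 10 ^ 7) * n ≤ 1 / 10 ^ 7 * n := by gcongr
      linarith
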